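/- Let $d$ be a natural number. All graphs are simple, countable (finite or infinite), not necessarily connected, and have all vertex degrees at most $d$. For a graph $G$, a vertex $x$ and an integer $r>0$, the rooted ball $B_r(G,x)$ is the subgraph induced on the vertices at distance at most $r$ from $x$, rooted at $x$; $\mathcal B_r(G)$ denotes the set of all rooted-isomorphism types of the balls $B_r(G,x)$, $x\in V(G)$. A sequence $(G_n)_{n\ge 1}$ converges to $G$ in the naive sense, $G_n\stackrel{n}{\to}G$, if for every $r>0$ and every rooted ball $B$, either $B\in\mathcal B_r(G_n)$ for all sufficiently large $n$ or $B\notin\mathcal B_r(G_n)$ for all sufficiently large $n$, and $B\in\mathcal B_r(G)$ if and only if $B\in \mathcal B_r(G_n)$ for all but finitely many $n$. For $H\subset V(G)$ let $\partial(H)$ be the set of vertices of $H$ having a neighbour outside $H$. An $(\varepsilon,K)$-partition of $G$ is a partition of $V(G)$ into finite nonempty classes $H_1,H_2,\dots$ such that, for each $j$, $d_G(x,y)\le K$ for all $x,y\in H_j$, and $|\partial(H_j)|/|H_j|\le\varepsilon$. A family $\mathcal G$ of graphs is strongly almost finite if for every $\varepsilon>0$ there are integers $T_\varepsilon>0$ and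 $K_\varepsilon>0$ such that every $G\in\mathcal G$ has $T_\varepsilon$ (not necessarily distinct) $(\varepsilon,K_\varepsilon)$-partitions $\{H^i_1,H^i_2,\dots\}$, $1\le i\le T_\varepsilon$, with $$\frac{|\{i : x\in\partial(H^i_j)\text{ for some } j\}|}{T_\varepsilon}<\varepsilon\qquad\text{for every } x\in V(G).$$ The Laplacian of $G$ is the bounded operator $\mathcal L_G$ on $\ell^2(V(G))$ given by $\mathcal L_G f(x)=\deg(x)f(x)-\sum_{y\sim x}f(y)$, and $\operatorname{Spec}(G)$ is its spectrum. **Theorem.** If $\{G_n\}_{n\ge1}$ is a strongly almost finite family and $G_n\stackrel{n}{\to}G$, then $\operatorname{Spec}(G_n)\to\operatorname{Spec}(G)$ in the Hausdorff metric. -/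

import Mathlib

namespace GraphLimit

/-! ### Bounded degree graphs, rooted balls and naive convergence -/

/-- Every vertex of the simple graph `G` has degree at most `d`. -/
def DegreeBound {V : Type*} (G : SimpleGraph V) (d : ℕ) : Prop :=
  ∀ x : V, (G.neighborSet x).encard ≤ d

/-- The vertex set of the closed ball of radius `r` around `x` in the graph metric; the extended
distance `edist` is infinite between distinct components. -/
def ballSet {V : Type*} (G : SimpleGraph V) (x : V) (r : ℕ) : Set V :=
  {y | G.edist x y ≤ r}

/-- A finite graph with a distinguished vertex, on a standard vertex set. Every ball in a graph of
bounded degree is finite, hence isomorphic to one of these. -/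
structure FiniteRootedGraph where
  card : ℕ
  graph : SimpleGraph (Fin card)
  root : Fin card

/-- The rooted balls of radius `r` contained in `G`: the finite rooted graphs that are
rooted-isomorphic to the subgraph induced on the ball of radius `r` around some vertex of `G`. -/
def rootedBalls {V : Type*} (G : SimpleGraph V) (r : ℕ) : Set FiniteRootedGraph :=
  {B | ∃ (x : V) (φ : B.graph ≃g G.induce (ballSet G x r)), (φ B.root : V) = x}

/-- Convergence of a sequence of graphs in the naive sense. -/
def NaivelyConvergent {V : ℕ → Type*} (G : ∀ n, SimpleGraph (V n)) : Prop :=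
  ∀ r : ℕ, 0 < r → ∀ B : FiniteRootedGraph,
    (∃ N, ∀ n ≥ N, B ∈ rootedBalls (G n) r) ∨ (∃ N, ∀ n ≥ N, B ∉ rootedBalls (G n) r)

/-- The graph `H` is a naive limit of the sequence `G`: the sequence converges in the naive sense,
and a rooted ball occurs in `H` if and only if it occurs in all but finitely many `G n`. -/
def NaiveLimit {V : ℕ → Type*} (G : ∀ n, SimpleGraph (V n))
    {W : Type*} (H : SimpleGraph W) : Prop :=
  NaivelyConvergent G ∧
    ∀ r : ℕ, 0 < r → ∀ B : FiniteRootedGraph,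
      B ∈ rootedBalls H r ↔ ∃ N, ∀ n ≥ N, B ∈ rootedBalls (G n) r

/-! ### Strong almost finiteness -/

/-- The vertices of `H` that have a neighbour outside `H`. -/
def vertexBoundary {V : Type*} (G : SimpleGraph V) (H : Set V) : Set V :=
  {x | x ∈ H ∧ ∃ y, y ∉ H ∧ G.Adj x y}

/-- `P` is an `(ε, K)`-partition of the vertex set of `G`: its classes are finite and nonempty,
any two vertices of a class are at distance at most `K` in `G`, and each class has isoperimetric
constant at most `ε`. -/
def IsEpsPartition {V : Type*} (G : SimpleGraph V) (ε : ℝ) (K : ℕ) (P : Set (Set V)) : Prop :=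
  Setoid.IsPartition P ∧
    ∀ H ∈ P, H.Finite ∧ (∀ x ∈ H, ∀ y ∈ H, G.edist x y ≤ K) ∧
      ((vertexBoundary G H).ncard : ℝ) / (H.ncard : ℝ) ≤ ε

/-- A family of graphs is strongly almost finite. The numbers `T` and `K` depend on `ε` only. -/
def StronglyAlmostFinite {ι : Type*} {V : ι → Type*} (G : ∀ i, SimpleGraph (V i)) : Prop :=
  ∀ ε : ℝ, 0 < ε → ∃ T K : ℕ, 0 < T ∧ 0 < K ∧
    ∀ i, ∃ P : Fin T → Set (Set (V i)),
      (∀ t, IsEpsPartition (G i) ε K (P t)) ∧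
      ∀ x : V i,
        (({t : Fin T | ∃ H ∈ P t, x ∈ vertexBoundary (G i) H}.ncard : ℝ) / (T : ℝ)) < ε

/-! ### The Laplacian on square-summable functions -/

/-- `(L f)(x) = deg(x) f(x) - ∑_{y ∼ x} f(y)`, as a function on vertices. -/
noncomputable def laplacianFun {V : Type*} (G : SimpleGraph V) (f : V → ℂ) (x : V) : ℂ :=
  ((G.neighborSet x).ncard : ℂ) * f x - ∑ᶠ y ∈ G.neighborSet x, f y

theorem DegreeBound.finite {V : Type*} {G : SimpleGraph V} {d : ℕ} (h : DegreeBound G d) (x : V) :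
    (G.neighborSet x).Finite :=
  Set.finite_of_encard_le_coe (h x)

theorem DegreeBound.card_le {V : Type*} {G : SimpleGraph V} {d : ℕ} (h : DegreeBound G d) (x : V) :
    (h.finite x).toFinset.card ≤ d := by
  have := h x
  rw [(h.finite x).encard_eq_coe_toFinset_card] at this
  exact_mod_cast this

theorem laplacianFun_eq_sum {V : Type*} {G : SimpleGraph V} {d : ℕ} (h : DegreeBound G d)
    (f : V → ℂ) (x : V) :
    laplacianFun G f x = ∑ y ∈ (h.finite x).toFinset, (f x - f y) := by
  rw [laplacianFun, finsum_mem_eq_finite_toFinset_sum _ (h.finite x),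
    Set.ncard_eq_toFinset_card _ (h.finite x), Finset.sum_sub_distrib, Finset.sum_const,
    nsmul_eq_mul]

theorem norm_laplacianFun_sq_le {V : Type*} {G : SimpleGraph V} {d : ℕ} (h : DegreeBound G d)
    (f : V → ℂ) (x : V) :
    ‖laplacianFun G f x‖ ^ 2 ≤
      2 * d ^ 2 * ‖f x‖ ^ 2 + 2 * d * ∑ y ∈ (h.finite x).toFinset, ‖f y‖ ^ 2 := by
  have hc : ((h.finite x).toFinset.card : ℝ) ≤ d := by exact_mod_cast h.card_le x
  rw [laplacianFun_eq_sum h]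
  calc ‖∑ y ∈ (h.finite x).toFinset, (f x - f y)‖ ^ 2
      ≤ (∑ y ∈ (h.finite x).toFinset, ‖f x - f y‖) ^ 2 := by gcongr; exact norm_sum_le _ _
    _ ≤ (h.finite x).toFinset.card * ∑ y ∈ (h.finite x).toFinset, ‖f x - f y‖ ^ 2 :=
        sq_sum_le_card_mul_sum_sq
    _ ≤ d * ∑ y ∈ (h.finite x).toFinset, (2 * ‖f x‖ ^ 2 + 2 * ‖f y‖ ^ 2) := by
        gcongr with y _
        nlinarith [norm_sub_le (f x) (f y), norm_nonneg (f x - f y), norm_nonneg (f x),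
          norm_nonneg (f y), sq_nonneg (‖f x‖ - ‖f y‖)]
    _ = d * ((h.finite x).toFinset.card * (2 * ‖f x‖ ^ 2)
          + 2 * ∑ y ∈ (h.finite x).toFinset, ‖f y‖ ^ 2) := by
        rw [Finset.sum_add_distrib, Finset.sum_const, nsmul_eq_mul, Finset.mul_sum]
    _ ≤ d * (d * (2 * ‖f x‖ ^ 2) + 2 * ∑ y ∈ (h.finite x).toFinset, ‖f y‖ ^ 2) := by gcongr
    _ = _ := by ring

theorem sum_neighbors_le {V : Type*} {G : SimpleGraph V} {d : ℕ} (h : DegreeBound G d)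
    {g : V → ℝ} (hg : ∀ y, 0 ≤ g y) {C : ℝ} (hC : ∀ s : Finset V, ∑ y ∈ s, g y ≤ C)
    (s : Finset V) :
    ∑ x ∈ s, ∑ y ∈ (h.finite x).toFinset, g y ≤ d * C := by
  classical
  have hswap : ∑ x ∈ s, ∑ y ∈ (h.finite x).toFinset, g y =
      ∑ y ∈ s.biUnion fun x => (h.finite x).toFinset,
        ∑ _x ∈ s ∩ (h.finite y).toFinset, g y := by
    apply Finset.sum_comm'
    intro x y
    simp only [Set.Finite.mem_toFinset, SimpleGraph.mem_neighborSet, Finset.mem_inter,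
      Finset.mem_biUnion]
    constructor
    · rintro ⟨hx, hxy⟩
      exact ⟨⟨hx, hxy.symm⟩, x, hx, hxy⟩
    · rintro ⟨⟨hx, hyx⟩, -⟩
      exact ⟨hx, hyx.symm⟩
  rw [hswap]
  calc _ ≤ ∑ y ∈ s.biUnion fun x => (h.finite x).toFinset, (d : ℝ) * g y := by
        refine Finset.sum_le_sum fun y _ => ?_
        rw [Finset.sum_const, nsmul_eq_mul]
        refine mul_le_mul_of_nonneg_right ?_ (hg y)
        exact_mod_cast (Finset.card_le_card Finset.inter_subset_right).trans (h.card_le y)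
    _ ≤ d * C := by
        rw [← Finset.mul_sum]
        exact mul_le_mul_of_nonneg_left (hC _) (Nat.cast_nonneg d)

theorem sum_norm_sq_le {V : Type*} (f : lp (fun _ : V => ℂ) 2) (s : Finset V) :
    ∑ x ∈ s, ‖f x‖ ^ 2 ≤ ‖f‖ ^ 2 := by
  have := lp.sum_rpow_le_norm_rpow (p := 2) (by simp) f s
  simpa using this

theorem sum_norm_laplacianFun_sq_le {V : Type*} {G : SimpleGraph V} {d : ℕ} (h : DegreeBound G d)
    (f : lp (fun _ : V => ℂ) 2) (s : Finset V) :
    ∑ x ∈ s, ‖laplacianFun G f x‖ ^ 2 ≤ (2 * d * ‖f‖) ^ 2 := by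
  calc ∑ x ∈ s, ‖laplacianFun G f x‖ ^ 2
      ≤ ∑ x ∈ s, (2 * d ^ 2 * ‖f x‖ ^ 2
          + 2 * d * ∑ y ∈ (h.finite x).toFinset, ‖f y‖ ^ 2) :=
        Finset.sum_le_sum fun x _ => norm_laplacianFun_sq_le h f x
    _ = 2 * d ^ 2 * ∑ x ∈ s, ‖f x‖ ^ 2
          + 2 * d * ∑ x ∈ s, ∑ y ∈ (h.finite x).toFinset, ‖f y‖ ^ 2 := by
        rw [Finset.sum_add_distrib, Finset.mul_sum, Finset.mul_sum]
    _ ≤ 2 * d ^ 2 * ‖f‖ ^ 2 + 2 * d * (d * ‖f‖ ^ 2) := by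
        gcongr
        · exact sum_norm_sq_le f s
        · exact sum_neighbors_le h (fun y => sq_nonneg _) (sum_norm_sq_le f) s
    _ = (2 * d * ‖f‖) ^ 2 := by ring

theorem memlp_laplacianFun {V : Type*} {G : SimpleGraph V} {d : ℕ} (h : DegreeBound G d)
    (f : lp (fun _ : V => ℂ) 2) : Memℓp (laplacianFun G f) 2 := by
  refine memℓp_gen' (C := (2 * d * ‖f‖) ^ 2) fun s => ?_
  simpa using sum_norm_laplacianFun_sq_le h f s

theorem laplacianFun_add {V : Type*} {G : SimpleGraph V} {d : ℕ} (h : DegreeBound G d)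
    (f g : V → ℂ) : laplacianFun G (f + g) = laplacianFun G f + laplacianFun G g := by
  ext x
  simp only [Pi.add_apply, laplacianFun_eq_sum h, ← Finset.sum_add_distrib]
  exact Finset.sum_congr rfl fun y _ => by ring

theorem laplacianFun_smul {V : Type*} {G : SimpleGraph V} {d : ℕ} (h : DegreeBound G d)
    (c : ℂ) (f : V → ℂ) : laplacianFun G (c • f) = c • laplacianFun G f := by
  ext x
  simp only [Pi.smul_apply, smul_eq_mul, laplacianFun_eq_sum h, Finset.mul_sum]
  exact Finset.sum_congr rfl fun y _ => by ring

/-- The Laplacian of a graph of bounded degree, as a bounded operator on the complex Hilbert space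
of square-summable functions on the vertices. -/
noncomputable def laplacian {V : Type*} (G : SimpleGraph V) (d : ℕ) (h : DegreeBound G d) :
    lp (fun _ : V => ℂ) 2 →L[ℂ] lp (fun _ : V => ℂ) 2 :=
  LinearMap.mkContinuous
    { toFun := fun f => ⟨laplacianFun G f, memlp_laplacianFun h f⟩
      map_add' := fun f g => by
        ext1
        exact laplacianFun_add h f g
      map_smul' := fun c f => by
        ext1
        exact laplacianFun_smul h c f }
    (2 * d)
    (fun f => by
      refine lp.norm_le_of_forall_sum_le (p := 2) (by simp) (by positivity) fun s => ?_
      simpa using sum_norm_laplacianFun_sq_le h f s)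

theorem laplacian_apply {V : Type*} (G : SimpleGraph V) (d : ℕ) (h : DegreeBound G d)
    (f : lp (fun _ : V => ℂ) 2) (x : V) :
    laplacian G d h f x = ((G.neighborSet x).ncard : ℂ) * f x - ∑ᶠ y ∈ G.neighborSet x, f y :=
  rfl

end GraphLimit

/-!
For a self-adjoint operator `L`, a number `z` is within `δ` of the spectrum as soon as some nonzero
`f` has `‖L f - z f‖ ≤ δ ‖f‖`, and every spectral value admits such approximate eigenfunctions for
all `δ > 0`. Let `χ` be a quadratic partition of unity on the vertices, `∑ₐ |χₐ|² = 1`, which varies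
little along edges. The commutators of `L` with the `χₐ` are then small, so that
`∑ₐ ‖(L - z)(χₐ f)‖²` exceeds a multiple of `‖(L - z) f‖²` by only a small multiple of
`‖f‖² = ∑ₐ ‖χₐ f‖²`, and some `χₐ f` is again an approximate eigenfunction. In a strongly almost
finite family the normalised indicators of the classes of the partitions form such a `χ`: an edge
is cut by few of the partitions. So spectral values of all graphs of the family are detected by
functions living on balls of one radius `r`. Whether this happens is decided by the rooted balls of
radius `r + 1`; there are only finitely many of these, so those of `Gₙ` and of the limit eventually
coincide. For spectral values of the limit the radius may depend on the spectral value, and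
compactness of the spectrum supplies the uniformity.
-/

open scoped InnerProductSpace ENNReal NNReal

namespace GraphLimit

section Operators

theorem isStarNormal_algebraMap_sub {R A : Type*} [CommRing R] [StarRing R] [Ring A] [StarRing A]
    [Algebra R A] [StarModule R A] {a : A} (ha : IsStarNormal a) (z : R) :
    IsStarNormal (algebraMap R A z - a) where
  star_comm_self := by
    rw [star_sub, ← algebraMap_star_comm]
    exact ((Algebra.commute_algebraMap_left _ _).sub_right (Algebra.commute_algebraMap_left _ _))
      |>.sub_left ((Algebra.commute_algebraMap_right _ _).sub_right ha.star_comm_self)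

theorem norm_algebraMap_sub_apply {𝕜 E : Type*} [NontriviallyNormedField 𝕜]
    [NormedAddCommGroup E] [NormedSpace 𝕜 E] (A : E →L[𝕜] E) (z : 𝕜) (f : E) :
    ‖(algebraMap 𝕜 (E →L[𝕜] E) z - A) f‖ = ‖A f - z • f‖ :=
  norm_sub_rev _ _

theorem exists_mul_sub_algebraMap_eq_one {𝒜 : Type*} [CStarAlgebra 𝒜] {a : 𝒜}
    (ha : IsStarNormal a) {z : ℂ} {ρ : ℝ} (hρ : 0 < ρ) (hz : ∀ w ∈ spectrum ℂ a, ρ ≤ dist z w) :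
    ∃ b : 𝒜, ‖b‖ ≤ ρ⁻¹ ∧ b * (algebraMap ℂ 𝒜 z - a) = 1 := by
  have hne : ∀ w ∈ spectrum ℂ a, z - w ≠ 0 := fun w hw =>
    sub_ne_zero.2 (dist_pos.1 (hρ.trans_le (hz w hw)))
  have hcont : ContinuousOn (fun w => (z - w)⁻¹) (spectrum ℂ a) := by
    fun_prop (disch := assumption)
  refine ⟨cfc (fun w => (z - w)⁻¹) a, norm_cfc_le (by positivity) fun w hw => ?_, ?_⟩
  · rw [norm_inv, ← dist_eq_norm]
    exact inv_anti₀ hρ (hz w hw)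
  · have hsub : algebraMap ℂ 𝒜 z - a = cfc (fun w => z - w) a := by
      rw [cfc_sub .., cfc_id' .., cfc_const ..]
    rw [hsub, ← cfc_mul .., ← cfc_one ℂ a]
    exact cfc_congr fun w hw => inv_mul_cancel₀ (hne w hw)

variable {E : Type*} [NormedAddCommGroup E] [CompleteSpace E]

theorem isUnit_of_forall_norm_le {𝕜 : Type*} [RCLike 𝕜] [InnerProductSpace 𝕜 E] {B : E →L[𝕜] E}
    (hB : IsStarNormal B) {K : ℝ≥0} (h : ∀ f, ‖f‖ ≤ K * ‖B f‖) : IsUnit B := by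
  have hanti : AntilipschitzWith K B := B.antilipschitz_of_bound h
  rw [ContinuousLinearMap.isUnit_iff_bijective,
    ContinuousLinearMap.bijective_iff_dense_range_and_antilipschitz]
  refine ⟨?_, K, hanti⟩
  rw [Submodule.topologicalClosure_eq_top_iff, ContinuousLinearMap.IsStarNormal.orthogonal_range hB]
  exact LinearMap.ker_eq_bot.2 hanti.injective

theorem exists_norm_sub_smul_lt_of_mem_spectrum {𝕜 : Type*} [RCLike 𝕜] [InnerProductSpace 𝕜 E]
    {A : E →L[𝕜] E} (hA : IsStarNormal A) {z : 𝕜} (hz : z ∈ spectrum 𝕜 A) {δ : ℝ≥0}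
    (hδ : 0 < δ) : ∃ f : E, ‖A f - z • f‖ < δ * ‖f‖ := by
  by_contra! hbelow
  refine hz (isUnit_of_forall_norm_le (isStarNormal_algebraMap_sub hA z) (K := δ⁻¹) fun f => ?_)
  rw [norm_algebraMap_sub_apply, NNReal.coe_inv, le_inv_mul_iff₀ (by exact_mod_cast hδ)]
  exact hbelow f

variable [InnerProductSpace ℂ E]

theorem infDist_spectrum_mul_norm_le {A : E →L[ℂ] E} (hA : IsStarNormal A) (z : ℂ) (f : E) :
    Metric.infDist z (spectrum ℂ A) * ‖f‖ ≤ ‖A f - z • f‖ := by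
  obtain hρ | hρ : 0 = Metric.infDist z (spectrum ℂ A) ∨ _ := Metric.infDist_nonneg.eq_or_lt
  · rw [← hρ, zero_mul]
    exact norm_nonneg _
  obtain ⟨R, hR, hRA⟩ := exists_mul_sub_algebraMap_eq_one hA hρ
    fun w hw => Metric.infDist_le_dist_of_mem hw
  calc Metric.infDist z (spectrum ℂ A) * ‖f‖
      = Metric.infDist z (spectrum ℂ A) * ‖R ((algebraMap ℂ (E →L[ℂ] E) z - A) f)‖ := by
        rw [← mul_apply_eq_comp, hRA, one_apply_eq_self]
    _ ≤ Metric.infDist z (spectrum ℂ A) *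
          ((Metric.infDist z (spectrum ℂ A))⁻¹ * ‖(algebraMap ℂ (E →L[ℂ] E) z - A) f‖) := by
        gcongr
        exact R.le_of_opNorm_le hR _
    _ = ‖A f - z • f‖ := by
        rw [mul_inv_cancel_left₀ hρ.ne', norm_algebraMap_sub_apply]

theorem infEDist_spectrum_le {A : E →L[ℂ] E} (hA : IsStarNormal A) {z : ℂ} {f : E} (hf : f ≠ 0)
    {δ : ℝ≥0∞} (h : ‖A f - z • f‖ₑ ≤ δ * ‖f‖ₑ) : Metric.infEDist z (spectrum ℂ A) ≤ δ := by
  have : Nontrivial E := ⟨f, 0, hf⟩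
  have hne : Metric.infEDist z (spectrum ℂ A) ≠ ∞ := Metric.infEDist_ne_top (spectrum.nonempty A)
  refine (ENNReal.mul_le_mul_iff_left (enorm_ne_zero.2 hf) enorm_ne_top).1 (le_trans ?_ h)
  rw [← ofReal_norm, ← ofReal_norm, ← ENNReal.ofReal_toReal hne,
    ← ENNReal.ofReal_mul ENNReal.toReal_nonneg]
  exact ENNReal.ofReal_le_ofReal (infDist_spectrum_mul_norm_le hA z f)

end Operators

section Energy

variable {V W : Type*}

/-- The square of the `ℓ²` norm of `f`. It takes values in `ℝ≥0∞`, so that sums may be interchanged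
without any summability assumption. -/
noncomputable def energy (f : V → ℂ) : ℝ≥0∞ := ∑' x, ‖f x‖ₑ ^ 2

/-- The function `L f - z f` on vertices, which is small when `f` is nearly an eigenfunction. -/
noncomputable def shiftedLaplacian (G : SimpleGraph V) (z : ℂ) (f : V → ℂ) : V → ℂ :=
  laplacianFun G f - z • f

/-- An approximate eigenfunction: a nonzero square-summable `f` with `‖L f - z f‖ ≤ δ ‖f‖`. -/
structure IsApproxEigenfunction (G : SimpleGraph V) (z : ℂ) (δ : ℝ≥0) (f : V → ℂ) : Prop where
  energy_ne_zero : energy f ≠ 0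
  energy_ne_top : energy f ≠ ∞
  energy_shiftedLaplacian_le : energy (shiftedLaplacian G z f) ≤ δ ^ 2 * energy f

theorem energy_eq_zero {f : V → ℂ} : energy f = 0 ↔ f = 0 := by
  simp [energy, funext_iff]

theorem energy_coe_lp (f : lp (fun _ : V => ℂ) 2) : energy f = ‖f‖ₑ ^ 2 := by
  have hnorm : ‖f‖ ^ 2 = ∑' x, ‖f x‖ ^ 2 := by
    simpa using lp.norm_rpow_eq_tsum (p := 2) (by simp) f
  have hsum : Summable fun x => ‖f x‖ ^ 2 := by
    simpa using (lp.memℓp f).summable (by simp)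
  rw [← ofReal_norm, ← ENNReal.ofReal_pow (norm_nonneg _), hnorm,
    ENNReal.ofReal_tsum_of_nonneg (fun x => by positivity) hsum, energy]
  refine tsum_congr fun x => ?_
  rw [ENNReal.ofReal_pow (norm_nonneg _), ofReal_norm]

theorem memℓp_of_energy_ne_top {f : V → ℂ} (hf : energy f ≠ ∞) : Memℓp f 2 := by
  rw [memℓp_gen_iff (by simp)]
  simpa using ENNReal.summable_toReal hf

theorem energy_comp_equiv (e : V ≃ W) (f : W → ℂ) : energy (f ∘ e) = energy f :=
  e.tsum_eq fun y => ‖f y‖ₑ ^ 2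

theorem energy_comp_val {S : Set V} {f : V → ℂ} (hf : f.support ⊆ S) :
    energy (f ∘ ((↑) : S → V)) = energy f := by
  refine tsum_subtype_eq_of_support_subset (f := fun y => ‖f y‖ₑ ^ 2) fun y hy => hf ?_
  simpa using hy

end Energy

section ApproximateEigenfunctions

variable {V : Type*} {G : SimpleGraph V} {d : ℕ}

theorem laplacian_single [DecidableEq V] (h : DegreeBound G d) (x : V) :
    laplacian G d h (lp.single 2 x (1 : ℂ)) =
      ∑ y ∈ (h.finite x).toFinset, (lp.single 2 x (1 : ℂ) - lp.single 2 y (1 : ℂ)) := by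
  ext z
  rw [lp.coeFn_sum, Finset.sum_apply]
  change laplacianFun G _ z = _
  rw [laplacianFun_eq_sum h]
  simp only [lp.coeFn_sub, Pi.sub_apply, lp.coeFn_single, Finset.sum_sub_distrib, Pi.single_apply]
  by_cases hzx : z = x
  · subst hzx
    simp [eq_comm]
  · have hadj : x ∈ (h.finite z).toFinset ↔ z ∈ (h.finite x).toFinset := by
      simp [SimpleGraph.adj_comm]
    simp [hzx, hadj, -Set.Finite.mem_toFinset]

theorem isSelfAdjoint_laplacian (h : DegreeBound G d) : IsSelfAdjoint (laplacian G d h) := by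
  classical
  rw [ContinuousLinearMap.isSelfAdjoint_iff']
  ext f x
  have apply_eq_inner (g : lp (fun _ : V => ℂ) 2) : g x = ⟪lp.single 2 x (1 : ℂ), g⟫_ℂ := by
    simp [lp.inner_single_left]
  rw [apply_eq_inner, ContinuousLinearMap.adjoint_inner_right, laplacian_single, sum_inner]
  change _ = laplacianFun G f x
  rw [laplacianFun_eq_sum h]
  refine Finset.sum_congr rfl fun y _ => ?_
  simp [inner_sub_left, lp.inner_single_left]

theorem energy_shiftedLaplacian_coe_lp (h : DegreeBound G d) (z : ℂ)
    (f : lp (fun _ : V => ℂ) 2) :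
    energy (shiftedLaplacian G z f) = ‖laplacian G d h f - z • f‖ₑ ^ 2 :=
  energy_coe_lp (laplacian G d h f - z • f)

theorem isApproxEigenfunction_coe_lp_iff (h : DegreeBound G d) {z : ℂ} {δ : ℝ≥0}
    {f : lp (fun _ : V => ℂ) 2} :
    IsApproxEigenfunction G z δ f ↔ f ≠ 0 ∧ ‖laplacian G d h f - z • f‖ₑ ≤ δ * ‖f‖ₑ := by
  have hle : energy (shiftedLaplacian G z f) ≤ δ ^ 2 * energy f ↔
      ‖laplacian G d h f - z • f‖ₑ ≤ δ * ‖f‖ₑ := by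
    rw [energy_shiftedLaplacian_coe_lp h, energy_coe_lp, ← mul_pow,
      ENNReal.pow_le_pow_left_iff two_ne_zero]
  have hzero : energy f ≠ 0 ↔ f ≠ 0 := by simp [energy_coe_lp]
  have htop : energy f ≠ ∞ := by simp [energy_coe_lp]
  exact ⟨fun hf => ⟨hzero.1 hf.1, hle.1 hf.3⟩, fun hf => ⟨hzero.2 hf.1, htop, hle.2 hf.2⟩⟩

theorem finite_support_sum_single [DecidableEq V] (s : Finset V) (f : V → ℂ) :
    (⇑(∑ x ∈ s, lp.single 2 x (f x) : lp (fun _ : V => ℂ) 2)).support.Finite := by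
  refine s.finite_toSet.subset fun x hx => ?_
  by_contra hxs
  refine hx ?_
  rw [lp.coeFn_sum, Finset.sum_apply]
  refine Finset.sum_eq_zero fun y hy => ?_
  exact Pi.single_eq_of_ne (ne_of_mem_of_not_mem hy hxs).symm _

theorem exists_finite_support_isApproxEigenfunction (h : DegreeBound G d) {z : ℂ}
    (hz : z ∈ spectrum ℂ (laplacian G d h)) {δ : ℝ≥0} (hδ : 0 < δ) :
    ∃ f : V → ℂ, f.support.Finite ∧ IsApproxEigenfunction G z δ f := by
  classical
  obtain ⟨f, hf⟩ :=
    exists_norm_sub_smul_lt_of_mem_spectrum (isSelfAdjoint_laplacian h).isStarNormal hz hδ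
  have hlim : Filter.Tendsto (fun s : Finset V => ∑ x ∈ s, lp.single 2 x (f x)) Filter.atTop
      (nhds f) := lp.hasSum_single (by simp) f
  have hopen : IsOpen {g : lp (fun _ : V => ℂ) 2 | ‖laplacian G d h g - z • g‖ < δ * ‖g‖} :=
    isOpen_lt (by fun_prop) (by fun_prop)
  obtain ⟨s, hs⟩ := (hlim.eventually (hopen.mem_nhds hf)).exists
  refine ⟨_, finite_support_sum_single s f, (isApproxEigenfunction_coe_lp_iff h).2 ⟨?_, ?_⟩⟩
  · exact norm_pos_iff.1 (pos_of_mul_pos_right ((norm_nonneg _).trans_lt hs) δ.coe_nonneg)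
  · simp only [enorm_eq_nnnorm]
    exact_mod_cast hs.le

theorem IsApproxEigenfunction.infEDist_spectrum_le (h : DegreeBound G d) {z : ℂ} {δ : ℝ≥0}
    {f : V → ℂ} (hf : IsApproxEigenfunction G z δ f) :
    Metric.infEDist z (spectrum ℂ (laplacian G d h)) ≤ δ := by
  obtain ⟨g, rfl⟩ : ∃ g : lp (fun _ : V => ℂ) 2, (g : V → ℂ) = f :=
    ⟨⟨f, memℓp_of_energy_ne_top hf.energy_ne_top⟩, rfl⟩
  obtain ⟨hg, hle⟩ := (isApproxEigenfunction_coe_lp_iff h).1 hf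
  exact GraphLimit.infEDist_spectrum_le (isSelfAdjoint_laplacian h).isStarNormal hg hle

end ApproximateEigenfunctions

section Localization

theorem enorm_add_sq_le {E : Type*} [SeminormedAddCommGroup E] (a b : E) :
    ‖a + b‖ₑ ^ 2 ≤ 2 * (‖a‖ₑ ^ 2 + ‖b‖ₑ ^ 2) := by
  simp only [enorm_eq_nnnorm]
  norm_cast
  exact (pow_le_pow_left₀ (by positivity) (nnnorm_add_le a b) 2).trans add_sq_le

theorem enorm_sum_sq_le {ι E : Type*} [SeminormedAddCommGroup E] (s : Finset ι) (a : ι → E) :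
    ‖∑ i ∈ s, a i‖ₑ ^ 2 ≤ s.card * ∑ i ∈ s, ‖a i‖ₑ ^ 2 := by
  simp only [enorm_eq_nnnorm]
  norm_cast
  exact (pow_le_pow_left₀ (by positivity) (nnnorm_sum_le s a) 2).trans sq_sum_le_card_mul_sum_sq

theorem exists_le_mul_of_tsum_le {ι : Type*} {u v : ι → ℝ≥0∞} {C : ℝ≥0∞}
    (hu : ∑' a, u a ≠ ∞) (hv : ∑' a, v a ≠ 0) (h : ∑' a, u a ≤ C * ∑' a, v a) :
    ∃ a, v a ≠ 0 ∧ u a ≤ C * v a := by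
  by_contra! hlt
  obtain ⟨a, ha⟩ : ∃ a, v a ≠ 0 := by simpa using hv
  have hle : ∀ b, C * v b ≤ u b := fun b => by
    obtain hb | hb := eq_or_ne (v b) 0
    · simp [hb]
    · exact (hlt b hb).le
  have hfin : ∑' b, C * v b ≠ ∞ := ne_top_of_le_ne_top hu (ENNReal.tsum_le_tsum hle)
  refine (ENNReal.tsum_lt_tsum hfin hle (hlt a ha)).not_ge ?_
  rwa [ENNReal.tsum_mul_left]

variable {V ι : Type*} {G : SimpleGraph V} {d : ℕ}

/-- A quadratic partition of unity with total squared variation at most `η` along every edge. -/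
structure IsSquarePartition (G : SimpleGraph V) (η : ℝ≥0) (χ : ι → V → ℂ) : Prop where
  tsum_sq : ∀ x, ∑' a, ‖χ a x‖ₑ ^ 2 = 1
  tsum_sub_sq_le : ∀ x y, G.Adj x y → ∑' a, ‖χ a x - χ a y‖ₑ ^ 2 ≤ η

theorem tsum_sum_neighborSet_le (h : DegreeBound G d) (g : V → ℝ≥0∞) :
    ∑' x, ∑ y ∈ (h.finite x).toFinset, g y ≤ d * ∑' y, g y := by
  classical
  have sum_eq_tsum_ite (x : V) (w : V → ℝ≥0∞) :
      ∑ y ∈ (h.finite x).toFinset, w y = ∑' y, if G.Adj x y then w y else 0 := by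
    rw [tsum_eq_sum (s := (h.finite x).toFinset) fun y hy => if_neg (by simpa using hy)]
    exact Finset.sum_congr rfl fun y hy => (if_pos (by simpa using hy)).symm
  calc ∑' x, ∑ y ∈ (h.finite x).toFinset, g y
      = ∑' y, ∑ _x ∈ (h.finite y).toFinset, g y := by
        simp only [sum_eq_tsum_ite]
        rw [ENNReal.tsum_comm]
        simp only [G.adj_comm]
    _ ≤ ∑' y, d * g y := by
        refine ENNReal.tsum_le_tsum fun y => ?_
        rw [Finset.sum_const, nsmul_eq_mul]
        gcongr
        exact h.card_le y
    _ = d * ∑' y, g y := ENNReal.tsum_mul_left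

theorem shiftedLaplacian_mul (h : DegreeBound G d) (z : ℂ) (χ f : V → ℂ) (x : V) :
    shiftedLaplacian G z (χ * f) x = χ x * shiftedLaplacian G z f x +
      ∑ y ∈ (h.finite x).toFinset, (χ x - χ y) * f y := by
  simp only [shiftedLaplacian, Pi.sub_apply, Pi.smul_apply, Pi.mul_apply, smul_eq_mul,
    laplacianFun_eq_sum h, mul_sub, Finset.mul_sum]
  rw [sub_add_eq_add_sub, ← Finset.sum_add_distrib, mul_left_comm]
  congr 1
  exact Finset.sum_congr rfl fun y _ => by ring

namespace IsSquarePartition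

variable {η : ℝ≥0} {χ : ι → V → ℂ}

theorem tsum_energy_mul (hχ : IsSquarePartition G η χ) (f : V → ℂ) :
    ∑' a, energy (χ a * f) = energy f := by
  unfold energy
  rw [ENNReal.tsum_comm]
  refine tsum_congr fun x => ?_
  simp only [Pi.mul_apply, enorm_mul, mul_pow]
  rw [ENNReal.tsum_mul_right, hχ.tsum_sq, one_mul]

theorem tsum_enorm_shiftedLaplacian_mul_sq_le (hχ : IsSquarePartition G η χ)
    (h : DegreeBound G d) (z : ℂ) (f : V → ℂ) (x : V) :
    ∑' a, ‖shiftedLaplacian G z (χ a * f) x‖ₑ ^ 2 ≤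
      2 * (‖shiftedLaplacian G z f x‖ₑ ^ 2 +
        d * (η * ∑ y ∈ (h.finite x).toFinset, ‖f y‖ₑ ^ 2)) := by
  have hcard : ((h.finite x).toFinset.card : ℝ≥0∞) ≤ d := by exact_mod_cast h.card_le x
  calc ∑' a, ‖shiftedLaplacian G z (χ a * f) x‖ₑ ^ 2
      ≤ ∑' a, 2 * (‖χ a x‖ₑ ^ 2 * ‖shiftedLaplacian G z f x‖ₑ ^ 2 +
          d * ∑ y ∈ (h.finite x).toFinset, ‖χ a x - χ a y‖ₑ ^ 2 * ‖f y‖ₑ ^ 2) := by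
        refine ENNReal.tsum_le_tsum fun a => ?_
        simp only [shiftedLaplacian_mul h, ← mul_pow, ← enorm_mul]
        refine (enorm_add_sq_le _ _).trans ?_
        gcongr
        exact (enorm_sum_sq_le _ _).trans (by gcongr)
    _ = 2 * (‖shiftedLaplacian G z f x‖ₑ ^ 2 + d * ∑ y ∈ (h.finite x).toFinset,
          (∑' a, ‖χ a x - χ a y‖ₑ ^ 2) * ‖f y‖ₑ ^ 2) := by
        rw [ENNReal.tsum_mul_left, ENNReal.tsum_add, ENNReal.tsum_mul_right, hχ.tsum_sq, one_mul,
          ENNReal.tsum_mul_left, Summable.tsum_finsetSum fun _ _ => ENNReal.summable]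
        simp only [ENNReal.tsum_mul_right]
    _ ≤ 2 * (‖shiftedLaplacian G z f x‖ₑ ^ 2 +
          d * ∑ y ∈ (h.finite x).toFinset, η * ‖f y‖ₑ ^ 2) := by
        gcongr with y hy
        exact hχ.tsum_sub_sq_le x y (by simpa using hy)
    _ = _ := by simp only [Finset.mul_sum]

theorem tsum_energy_shiftedLaplacian_mul_le (hχ : IsSquarePartition G η χ)
    (h : DegreeBound G d) (z : ℂ) (f : V → ℂ) :
    ∑' a, energy (shiftedLaplacian G z (χ a * f)) ≤
      2 * (energy (shiftedLaplacian G z f) + d ^ 2 * η * energy f) := by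
  calc ∑' a, energy (shiftedLaplacian G z (χ a * f))
      = ∑' x, ∑' a, ‖shiftedLaplacian G z (χ a * f) x‖ₑ ^ 2 := ENNReal.tsum_comm
    _ ≤ ∑' x, 2 * (‖shiftedLaplacian G z f x‖ₑ ^ 2 +
          d * (η * ∑ y ∈ (h.finite x).toFinset, ‖f y‖ₑ ^ 2)) :=
        ENNReal.tsum_le_tsum fun x => hχ.tsum_enorm_shiftedLaplacian_mul_sq_le h z f x
    _ = 2 * (energy (shiftedLaplacian G z f) +
          d * (η * ∑' x, ∑ y ∈ (h.finite x).toFinset, ‖f y‖ₑ ^ 2)) := by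
        simp only [ENNReal.tsum_mul_left, ENNReal.tsum_add, energy]
    _ ≤ 2 * (energy (shiftedLaplacian G z f) + d * (η * (d * energy f))) := by
        gcongr
        exact tsum_sum_neighborSet_le h _
    _ = 2 * (energy (shiftedLaplacian G z f) + d ^ 2 * η * energy f) := by ring

theorem exists_isApproxEigenfunction_mul (hχ : IsSquarePartition G η χ) (h : DegreeBound G d)
    {z : ℂ} {δ δ' : ℝ≥0} {f : V → ℂ} (hf : IsApproxEigenfunction G z δ f)
    (hδ : 2 * (δ ^ 2 + d ^ 2 * η) ≤ δ' ^ 2) :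
    ∃ a, IsApproxEigenfunction G z δ' (χ a * f) := by
  have hsum : ∑' a, energy (shiftedLaplacian G z (χ a * f)) ≤ δ' ^ 2 * energy f :=
    calc ∑' a, energy (shiftedLaplacian G z (χ a * f))
        ≤ 2 * (energy (shiftedLaplacian G z f) + d ^ 2 * η * energy f) :=
          hχ.tsum_energy_shiftedLaplacian_mul_le h z f
      _ ≤ 2 * (δ ^ 2 * energy f + d ^ 2 * η * energy f) := by
          gcongr
          exact hf.energy_shiftedLaplacian_le
      _ = 2 * (δ ^ 2 + d ^ 2 * η) * energy f := by ring
      _ ≤ δ' ^ 2 * energy f := by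
          gcongr
          exact_mod_cast hδ
  obtain ⟨a, ha, hle⟩ := exists_le_mul_of_tsum_le (v := fun a => energy (χ a * f))
    (ne_top_of_le_ne_top (ENNReal.mul_ne_top (by simp) hf.energy_ne_top) hsum)
    (by rw [hχ.tsum_energy_mul]; exact hf.energy_ne_zero) (by rwa [hχ.tsum_energy_mul])
  refine ⟨a, ha, ne_top_of_le_ne_top hf.energy_ne_top ?_, hle⟩
  rw [← hχ.tsum_energy_mul f]
  exact ENNReal.le_tsum a

end IsSquarePartition

end Localization

section Colorings

theorem enorm_inv_sqrt_natCast_sq {n : ℕ} (hn : 0 < n) :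
    ‖((√(n : ℝ) : ℝ) : ℂ)⁻¹‖ₑ ^ 2 = (n : ℝ≥0∞)⁻¹ := by
  rw [← ofReal_norm, ← ENNReal.ofReal_pow (norm_nonneg _), norm_inv, Complex.norm_real, inv_pow,
    Real.norm_of_nonneg (Real.sqrt_nonneg _), Real.sq_sqrt n.cast_nonneg,
    ENNReal.ofReal_inv_of_pos (by exact_mod_cast hn), ENNReal.ofReal_natCast]

theorem tsum_enorm_ite_sub_ite_sq {α : Type*} [DecidableEq α] (i j : α) (w : ℂ) :
    ∑' a, ‖(if i = a then w else 0) - (if j = a then w else 0)‖ₑ ^ 2 =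
      if i = j then 0 else 2 * ‖w‖ₑ ^ 2 := by
  split_ifs with hij
  · simp [hij]
  · have hsplit (a : α) : ‖(if i = a then w else 0) - (if j = a then w else 0)‖ₑ ^ 2 =
        (if a = i then ‖w‖ₑ ^ 2 else 0) + (if a = j then ‖w‖ₑ ^ 2 else 0) := by
      obtain rfl | hi := eq_or_ne a i
      · simp [hij, Ne.symm hij]
      · simp [hi, hi.symm, eq_comm (a := a), apply_ite (‖·‖ₑ ^ 2)]
    simp only [hsplit, ENNReal.tsum_add, tsum_ite_eq, two_mul]

variable {V κ α : Type*} [Fintype κ] {G : SimpleGraph V}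

open Classical in
/-- The normalised indicator functions of all colour classes of a finite family of colourings `c`
of the vertices. -/
noncomputable def colorPartition (c : κ → V → α) (a : κ × α) (x : V) : ℂ :=
  if c a.1 x = a.2 then ((√(Fintype.card κ : ℝ) : ℝ) : ℂ)⁻¹ else 0

theorem apply_eq_of_mem_support_colorPartition {c : κ → V → α} {a : κ × α} {x : V}
    (hx : x ∈ (colorPartition c a).support) : c a.1 x = a.2 := by
  by_contra hne
  exact hx (if_neg hne)

theorem isSquarePartition_colorPartition [Nonempty κ] {c : κ → V → α} {η : ℝ≥0}
    (hc : ∀ x y, G.Adj x y → 2 * ({t | c t x ≠ c t y}.ncard : ℝ) ≤ η * Fintype.card κ) :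
    IsSquarePartition G η (colorPartition c) where
  tsum_sq x := by
    classical
    simp only [ENNReal.tsum_prod', tsum_fintype, colorPartition, apply_ite (‖·‖ₑ ^ 2), enorm_zero,
      zero_pow two_ne_zero, tsum_ite_eq', Finset.sum_const, Finset.card_univ, nsmul_eq_mul,
      enorm_inv_sqrt_natCast_sq Fintype.card_pos]
    exact ENNReal.mul_inv_cancel (by simp) (by simp)
  tsum_sub_sq_le x y hxy := by
    classical
    have hcard : 2 * ({t | c t x ≠ c t y}.ncard : ℝ≥0∞) ≤ η * Fintype.card κ := by
      exact_mod_cast hc x y hxy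
    calc ∑' a, ‖colorPartition c a x - colorPartition c a y‖ₑ ^ 2
        = ∑ t, if c t x = c t y then 0 else 2 * (Fintype.card κ : ℝ≥0∞)⁻¹ := by
          simp only [ENNReal.tsum_prod', tsum_fintype, colorPartition, tsum_enorm_ite_sub_ite_sq,
            enorm_inv_sqrt_natCast_sq Fintype.card_pos]
      _ = 2 * {t | c t x ≠ c t y}.ncard / Fintype.card κ := by
          rw [Finset.sum_ite, Finset.sum_const_zero, zero_add, Finset.sum_const, nsmul_eq_mul,
            Set.ncard_eq_toFinset_card', Set.toFinset_ofPred, mul_left_comm, ← mul_assoc]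
          rfl
      _ ≤ η := ENNReal.div_le_of_le_mul hcard

end Colorings

section LocalEigenfunctions

/-- Property A, uniformly over a family of graphs, in its formulation by quadratic partitions of
unity: for every `η` there are partitions with variation at most `η` along edges whose members
are supported in balls of a radius that depends on `η` only. -/
def UniformPropertyA.{u} {I : Type*} {V : I → Type u} (G : ∀ i, SimpleGraph (V i)) : Prop :=
  ∀ η : ℝ≥0, 0 < η → ∃ r : ℕ, ∀ i, ∃ (ι : Type u) (χ : ι → V i → ℂ),
    IsSquarePartition (G i) η χ ∧
      ∀ a, ∀ x ∈ (χ a).support, (χ a).support ⊆ ballSet (G i) x r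

theorem StronglyAlmostFinite.uniformPropertyA {I : Type*} {V : I → Type*}
    {G : ∀ i, SimpleGraph (V i)} (hG : StronglyAlmostFinite G) : UniformPropertyA G := by
  intro η hη
  obtain ⟨T, K, hT, -, hpartition⟩ := hG (η / 2) (by positivity)
  refine ⟨K, fun i => ?_⟩
  obtain ⟨P, hP, hboundary⟩ := hpartition i
  have : Nonempty (Fin T) := ⟨⟨0, hT⟩⟩
  choose c hc hunique using fun t x => (hP t).1.2 x
  refine ⟨Fin T × Set (V i), colorPartition c,
    isSquarePartition_colorPartition fun x y hxy => ?_, fun a x hx y hy => ?_⟩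
  · have hsub : {t | c t x ≠ c t y} ⊆ {t | ∃ H ∈ P t, x ∈ vertexBoundary (G i) H} := fun t ht =>
      ⟨c t x, (hc t x).1, (hc t x).2, y, fun hy => ht (hunique t y _ ⟨(hc t x).1, hy⟩), hxy⟩
    have hcard : ({t | c t x ≠ c t y}.ncard : ℝ) ≤
        {t | ∃ H ∈ P t, x ∈ vertexBoundary (G i) H}.ncard := by
      exact_mod_cast Set.ncard_le_ncard hsub
    have hlt := hboundary x
    rw [div_lt_iff₀ (by exact_mod_cast hT)] at hlt
    rw [Fintype.card_fin]
    linarith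
  · have hmem {w : V i} (hw : w ∈ (colorPartition c a).support) : w ∈ a.2 ∧ a.2 ∈ P a.1 := by
      rw [← apply_eq_of_mem_support_colorPartition hw]
      exact (hc a.1 w).symm
    exact ((hP a.1).2 a.2 (hmem hx).2).2.1 x (hmem hx).1 y (hmem hy).1

/-- There is an approximate eigenfunction supported in the ball of radius `r` around `x`. -/
def HasLocalEigenfunction {V : Type*} (G : SimpleGraph V) (z : ℂ) (δ : ℝ≥0) (r : ℕ) (x : V) :
    Prop :=
  ∃ f : V → ℂ, f.support ⊆ ballSet G x r ∧ IsApproxEigenfunction G z δ f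

theorem IsSquarePartition.exists_hasLocalEigenfunction {V ι : Type*} {G : SimpleGraph V} {d : ℕ}
    {η : ℝ≥0} {χ : ι → V → ℂ} (hχ : IsSquarePartition G η χ) (h : DegreeBound G d) {z : ℂ}
    {δ δ' : ℝ≥0} {f : V → ℂ} (hf : IsApproxEigenfunction G z δ f)
    (hδ : 2 * (δ ^ 2 + d ^ 2 * η) ≤ δ' ^ 2) {r : ℕ}
    (hr : ∀ a, ∀ x ∈ (χ a * f).support, (χ a * f).support ⊆ ballSet G x r) :
    ∃ x, HasLocalEigenfunction G z δ' r x := by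
  obtain ⟨a, ha⟩ := hχ.exists_isApproxEigenfunction_mul h hf hδ
  obtain ⟨x, hx⟩ : (χ a * f).support.Nonempty :=
    Function.support_nonempty_iff.2 (energy_eq_zero.not.1 ha.energy_ne_zero)
  exact ⟨x, χ a * f, hr a x hx, ha⟩

theorem UniformPropertyA.exists_hasLocalEigenfunction {I : Type*} {V : I → Type*}
    {G : ∀ i, SimpleGraph (V i)} {d : ℕ} (hA : UniformPropertyA G) (h : ∀ i, DegreeBound (G i) d)
    {δ : ℝ≥0} (hδ : 0 < δ) :
    ∃ r : ℕ, ∀ i, ∀ z ∈ spectrum ℂ (laplacian (G i) d (h i)),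
      ∃ x, HasLocalEigenfunction (G i) z δ r x := by
  have hη : 2 * ((δ / 2) ^ 2 + d ^ 2 * (δ ^ 2 / (4 * (d ^ 2 + 1)))) ≤ δ ^ 2 := by
    rw [← NNReal.coe_le_coe]
    push_cast
    field_simp
    nlinarith
  obtain ⟨r, hr⟩ := hA (δ ^ 2 / (4 * (d ^ 2 + 1))) (by positivity)
  refine ⟨r, fun i z hz => ?_⟩
  obtain ⟨ι, χ, hχ, hsupp⟩ := hr i
  obtain ⟨f, -, hf⟩ := exists_finite_support_isApproxEigenfunction (h i) hz (half_pos hδ)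
  refine hχ.exists_hasLocalEigenfunction (h i) hf hη fun a x hx => ?_
  have hsub : (χ a * f).support ⊆ (χ a).support := Function.support_mul_subset_left _ _
  exact hsub.trans (hsupp a x (hsub hx))

theorem exists_hasLocalEigenfunction_of_mem_spectrum {V : Type*} {G : SimpleGraph V} {d : ℕ}
    (h : DegreeBound G d) {z : ℂ} (hz : z ∈ spectrum ℂ (laplacian G d h)) {δ : ℝ≥0}
    (hδ : 0 < δ) : ∃ r x, HasLocalEigenfunction G z δ r x := by
  obtain ⟨f, hfin, hf⟩ := exists_finite_support_isApproxEigenfunction h hz (half_pos hδ)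
  -- `f` may meet several components, so it is cut down to a single one before measuring distances.
  have hχ : IsSquarePartition G 0 (colorPartition fun (_ : Unit) => G.connectedComponentMk) :=
    isSquarePartition_colorPartition fun x y hxy => by
      simp [SimpleGraph.ConnectedComponent.sound hxy.reachable]
  obtain ⟨r, hr⟩ : ∃ r : ℕ, ∀ p ∈ f.support ×ˢ f.support, G.dist p.1 p.2 ≤ r :=
    ((hfin.prod hfin).image fun p => G.dist p.1 p.2).bddAbove.imp fun r hr p hp =>
      hr ⟨p, hp, rfl⟩
  refine ⟨r, hχ.exists_hasLocalEigenfunction h hf ?_ fun a x hx y hy => ?_⟩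
  · rw [← NNReal.coe_le_coe]
    push_cast
    nlinarith
  · rw [Function.support_mul', Set.mem_inter_iff] at hx hy
    have hreach : G.Reachable x y := SimpleGraph.ConnectedComponent.exact <|
      (apply_eq_of_mem_support_colorPartition hx.1).trans
        (apply_eq_of_mem_support_colorPartition hy.1).symm
    rw [ballSet, Set.mem_ofPred_eq, ← hreach.coe_dist_eq_edist]
    exact_mod_cast hr (x, y) ⟨hx.2, hy.2⟩

end LocalEigenfunctions

section Balls

variable {V W : Type*} {G : SimpleGraph V} {H : SimpleGraph W} {d : ℕ}

theorem mem_ballSet_iff_exists_walk {x y : V} {r : ℕ} :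
    y ∈ ballSet G x r ↔ ∃ p : G.Walk x y, p.length ≤ r := by
  refine ⟨fun hy => ?_, fun ⟨p, hp⟩ => (SimpleGraph.edist_le p).trans (by exact_mod_cast hp)⟩
  obtain ⟨p, hp⟩ := SimpleGraph.exists_walk_of_edist_ne_top (ne_top_of_le_ne_top (by simp) hy)
  exact ⟨p, by exact_mod_cast hp.trans_le hy⟩

theorem self_mem_ballSet (G : SimpleGraph V) (x : V) (r : ℕ) : x ∈ ballSet G x r := by
  simp [ballSet]

theorem ballSet_zero (G : SimpleGraph V) (x : V) : ballSet G x 0 = {x} := by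
  ext y
  simp [ballSet, @eq_comm _ y]

theorem ballSet_mono (G : SimpleGraph V) (x : V) : Monotone (ballSet G x) :=
  fun _ _ hrs _ (hy : G.edist x _ ≤ _) => hy.trans (by exact_mod_cast hrs)

theorem mem_ballSet_succ_iff {x y : V} {r : ℕ} :
    y ∈ ballSet G x (r + 1) ↔ y ∈ ballSet G x r ∨ ∃ y' ∈ ballSet G x r, G.Adj y' y := by
  constructor
  · rw [mem_ballSet_iff_exists_walk]
    rintro ⟨p | ⟨hadj, p⟩, hp⟩
    · exact .inl (self_mem_ballSet G x r)
    · obtain ⟨y', q, hadj', hq⟩ := p.exists_cons_eq_concat hadj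
      rw [hq, SimpleGraph.Walk.length_concat] at hp
      exact .inr ⟨y', mem_ballSet_iff_exists_walk.2 ⟨q, by lia⟩, hadj'⟩
  · rintro (hy | ⟨y', hy', hadj⟩)
    · exact ballSet_mono G x r.le_succ hy
    · obtain ⟨p, hp⟩ := mem_ballSet_iff_exists_walk.1 hy'
      exact mem_ballSet_iff_exists_walk.2 ⟨p.concat hadj, by simpa using hp⟩

theorem neighborSet_subset_ballSet_succ {x y : V} {r : ℕ} (hy : y ∈ ballSet G x r) :
    G.neighborSet y ⊆ ballSet G x (r + 1) :=
  fun _ hadj => mem_ballSet_succ_iff.2 (.inr ⟨y, hy, hadj⟩)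

theorem map_mem_ballSet (φ : G →g H) {x y : V} {r : ℕ} (hy : y ∈ ballSet G x r) :
    φ y ∈ ballSet H (φ x) r := by
  obtain ⟨p, hp⟩ := mem_ballSet_iff_exists_walk.1 hy
  exact mem_ballSet_iff_exists_walk.2 ⟨p.map φ, by simpa using hp⟩

theorem mem_ballSet_induce_ballSet_iff {x : V} {k R : ℕ} (hk : k ≤ R) (y : ballSet G x R) :
    y ∈ ballSet (G.induce (ballSet G x R)) ⟨x, self_mem_ballSet G x R⟩ k ↔
      (y : V) ∈ ballSet G x k := by
  refine ⟨map_mem_ballSet (SimpleGraph.Embedding.induce _).toHom, fun hy => ?_⟩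
  induction k generalizing y with
  | zero =>
    rw [ballSet_zero, Set.mem_singleton_iff] at hy ⊢
    exact Subtype.ext hy
  | succ k ih =>
    rw [mem_ballSet_succ_iff] at hy ⊢
    exact hy.imp (ih (by lia) y) fun ⟨y', hy', hadj⟩ =>
      ⟨⟨y', ballSet_mono G x (by lia) hy'⟩, ih (by lia) _ hy', hadj⟩

theorem encard_ballSet_le (h : DegreeBound G d) (x : V) (r : ℕ) :
    (ballSet G x r).encard ≤ ((d + 1) ^ r : ℕ) := by
  classical
  induction r with
  | zero => simp [ballSet_zero]
  | succ r ih =>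
    have hfin : (ballSet G x r).Finite := Set.finite_of_encard_le_coe ih
    have hsub : ballSet G x (r + 1) ⊆
        (hfin.toFinset.biUnion fun y => insert y (h.finite y).toFinset : Finset V) := by
      intro y hy
      simp only [Finset.coe_biUnion, Set.mem_iUnion, Set.Finite.coe_toFinset]
      obtain hy | ⟨y', hy', hadj⟩ := mem_ballSet_succ_iff.1 hy
      · exact ⟨y, hy, by simp⟩
      · exact ⟨y', hy', by simp [hadj]⟩
    refine (Set.encard_le_encard hsub).trans ?_
    rw [Set.encard_coe_eq_coe_finsetCard, pow_succ]
    rw [hfin.encard_eq_coe_toFinset_card] at ih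
    norm_cast at ih ⊢
    exact (Finset.card_biUnion_le_card_mul _ _ (d + 1) fun y _ =>
      (Finset.card_insert_le _ _).trans (Nat.succ_le_succ (h.card_le y))).trans
        (Nat.mul_le_mul_right _ ih)

end Balls

section Transfer

variable {V W : Type*} {G : SimpleGraph V} {H : SimpleGraph W} {z : ℂ} {δ : ℝ≥0}

theorem isApproxEigenfunction_iff {f : V → ℂ} : IsApproxEigenfunction G z δ f ↔
    energy f ≠ 0 ∧ energy f ≠ ∞ ∧ energy (shiftedLaplacian G z f) ≤ δ ^ 2 * energy f :=
  ⟨fun h => ⟨h.1, h.2, h.3⟩, fun h => ⟨h.1, h.2.1, h.2.2⟩⟩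

theorem shiftedLaplacian_comp_iso (φ : G ≃g H) (z : ℂ) (f : W → ℂ) :
    shiftedLaplacian G z (f ∘ φ) = shiftedLaplacian H z f ∘ φ := by
  ext x
  have himage : φ '' G.neighborSet x = H.neighborSet (φ x) := by
    ext y
    obtain ⟨y, rfl⟩ := φ.surjective y
    simp [φ.map_adj_iff]
  simp only [shiftedLaplacian, laplacianFun, Function.comp_apply, Pi.sub_apply, Pi.smul_apply,
    ← himage, finsum_mem_image φ.injective.injOn, Set.ncard_image_of_injective _ φ.injective]

theorem isApproxEigenfunction_comp_iso_iff (φ : G ≃g H) {f : W → ℂ} :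
    IsApproxEigenfunction G z δ (f ∘ φ) ↔ IsApproxEigenfunction H z δ f := by
  have henergy (g : W → ℂ) : energy (g ∘ φ) = energy g := energy_comp_equiv φ.toEquiv g
  simp only [isApproxEigenfunction_iff, shiftedLaplacian_comp_iso, henergy]

theorem support_shiftedLaplacian_subset {S : Set V} {f : V → ℂ} (hS : f.support ⊆ S)
    (hN : ∀ y ∈ f.support, G.neighborSet y ⊆ S) : (shiftedLaplacian G z f).support ⊆ S := by
  intro x hx
  by_contra hxS
  have hfx : f x = 0 := Function.notMem_support.1 fun hfx => hxS (hS hfx)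
  have hsum : ∑ᶠ y ∈ G.neighborSet x, f y = 0 := finsum_mem_eq_zero_of_forall_eq_zero
    fun y hxy => Function.notMem_support.1 fun hfy => hxS (hN y hfy (G.adj_symm hxy))
  exact hx (by rw [shiftedLaplacian, Pi.sub_apply, Pi.smul_apply, laplacianFun, hsum, hfx]; simp)

theorem shiftedLaplacian_comp_val {S : Set V} {f : V → ℂ} (hS : f.support ⊆ S)
    (hN : ∀ y ∈ f.support, G.neighborSet y ⊆ S) :
    shiftedLaplacian (G.induce S) z (f ∘ (↑)) = shiftedLaplacian G z f ∘ ((↑) : S → V) := by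
  ext x
  have himage : Subtype.val '' (G.induce S).neighborSet x = G.neighborSet x ∩ S := by
    ext y
    simp [and_comm]
  have hsum : ∑ᶠ y ∈ (G.induce S).neighborSet x, f y = ∑ᶠ y ∈ G.neighborSet x, f y := by
    rw [← finsum_mem_image (f := f) (g := Subtype.val) Subtype.val_injective.injOn, himage]
    exact finsum_mem_inter_support_eq' _ _ _ fun y hy => by simp [hS hy]
  have hdeg : (((G.induce S).neighborSet x).ncard : ℂ) * f x =
      (G.neighborSet x).ncard * f x := by
    by_cases hx : f x = 0
    · simp [hx]
    · rw [← Set.ncard_image_of_injective _ Subtype.val_injective, himage,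
        Set.inter_eq_self_of_subset_left (hN x hx)]
  simp only [shiftedLaplacian, laplacianFun, Pi.sub_apply, Pi.smul_apply, Function.comp_apply,
    hsum, hdeg]

theorem isApproxEigenfunction_comp_val_iff {S : Set V} {f : V → ℂ} (hS : f.support ⊆ S)
    (hN : ∀ y ∈ f.support, G.neighborSet y ⊆ S) :
    IsApproxEigenfunction (G.induce S) z δ (f ∘ (↑)) ↔ IsApproxEigenfunction G z δ f := by
  rw [isApproxEigenfunction_iff, isApproxEigenfunction_iff, shiftedLaplacian_comp_val hS hN,
    energy_comp_val hS, energy_comp_val (support_shiftedLaplacian_subset hS hN)]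

variable {r : ℕ}

theorem HasLocalEigenfunction.map_iso (φ : G ≃g H) {x : V} (hx : HasLocalEigenfunction G z δ r x) :
    HasLocalEigenfunction H z δ r (φ x) := by
  obtain ⟨f, hf, hfz⟩ := hx
  refine ⟨f ∘ φ.symm, fun w hw => ?_, (isApproxEigenfunction_comp_iso_iff φ.symm).2 hfz⟩
  simpa using map_mem_ballSet φ.toHom (hf hw)

theorem hasLocalEigenfunction_map_iso_iff (φ : G ≃g H) {x : V} :
    HasLocalEigenfunction H z δ r (φ x) ↔ HasLocalEigenfunction G z δ r x :=
  ⟨fun h => by simpa using h.map_iso φ.symm, .map_iso φ⟩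

theorem hasLocalEigenfunction_induce_ballSet_iff {x : V} :
    HasLocalEigenfunction (G.induce (ballSet G x (r + 1))) z δ r
        ⟨x, self_mem_ballSet G x (r + 1)⟩ ↔
      HasLocalEigenfunction G z δ r x := by
  have hinner {f : V → ℂ} (hf : f.support ⊆ ballSet G x r) :
      IsApproxEigenfunction (G.induce (ballSet G x (r + 1))) z δ (f ∘ (↑)) ↔
        IsApproxEigenfunction G z δ f :=
    isApproxEigenfunction_comp_val_iff (hf.trans (ballSet_mono G x r.le_succ))
      fun y hy => neighborSet_subset_ballSet_succ (hf hy)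
  constructor
  · rintro ⟨g, hg, hgz⟩
    have hsupp : (Function.extend Subtype.val g 0).support ⊆ ballSet G x r := by
      rw [Function.support_extend_zero Subtype.val_injective]
      rintro _ ⟨y, hy, rfl⟩
      exact (mem_ballSet_induce_ballSet_iff r.le_succ y).1 (hg hy)
    refine ⟨_, hsupp, (hinner hsupp).1 ?_⟩
    rwa [Function.extend_comp Subtype.val_injective]
  · rintro ⟨f, hf, hfz⟩
    exact ⟨f ∘ (↑), fun y hy => (mem_ballSet_induce_ballSet_iff r.le_succ y).2 (hf hy),
      (hinner hf).2 hfz⟩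

theorem hasLocalEigenfunction_root_iff {B : FiniteRootedGraph} {x : V}
    (φ : B.graph ≃g G.induce (ballSet G x (r + 1))) (hφ : (φ B.root : V) = x) :
    HasLocalEigenfunction B.graph z δ r B.root ↔ HasLocalEigenfunction G z δ r x := by
  have hroot : φ B.root = ⟨x, self_mem_ballSet G x (r + 1)⟩ := Subtype.ext hφ
  rw [← hasLocalEigenfunction_map_iso_iff φ, hroot, hasLocalEigenfunction_induce_ballSet_iff]

end Transfer

section RootedBalls

variable {V : Type*} {G : SimpleGraph V} {d : ℕ}

theorem exists_iso_ballSet (h : DegreeBound G d) (x : V) (r : ℕ) :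
    ∃ (B : FiniteRootedGraph) (φ : B.graph ≃g G.induce (ballSet G x r)), (φ B.root : V) = x := by
  have hfin : (ballSet G x r).Finite := Set.finite_of_encard_le_coe (encard_ballSet_le h x r)
  have := hfin.to_subtype
  obtain ⟨n, ⟨e⟩⟩ := Finite.exists_equiv_fin (ballSet G x r)
  refine ⟨⟨n, (G.induce (ballSet G x r)).comap e.symm, e ⟨x, self_mem_ballSet G x r⟩⟩,
    SimpleGraph.Iso.comap e.symm _, ?_⟩
  exact congrArg Subtype.val (e.symm_apply_apply _)

theorem exists_hasLocalEigenfunction_iff (h : DegreeBound G d) {z : ℂ} {δ : ℝ≥0} {r : ℕ} :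
    (∃ x, HasLocalEigenfunction G z δ r x) ↔
      ∃ B ∈ rootedBalls G (r + 1), HasLocalEigenfunction B.graph z δ r B.root := by
  constructor
  · rintro ⟨x, hx⟩
    obtain ⟨B, φ, hφ⟩ := exists_iso_ballSet h x (r + 1)
    exact ⟨B, ⟨x, φ, hφ⟩, (hasLocalEigenfunction_root_iff φ hφ).2 hx⟩
  · rintro ⟨B, ⟨x, φ, hφ⟩, hB⟩
    exact ⟨x, (hasLocalEigenfunction_root_iff φ hφ).1 hB⟩

theorem card_le_of_mem_rootedBalls (h : DegreeBound G d) {r : ℕ} {B : FiniteRootedGraph}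
    (hB : B ∈ rootedBalls G r) : B.card ≤ (d + 1) ^ r := by
  obtain ⟨x, φ, -⟩ := hB
  have hle := encard_ballSet_le h x r
  rw [Set.encard, ← ENat.card_congr φ.toEquiv, ENat.card_eq_coe_fintype_card,
    Fintype.card_fin] at hle
  exact_mod_cast hle

theorem finite_setOf_card_le (M : ℕ) : {B : FiniteRootedGraph | B.card ≤ M}.Finite := by
  have hsub : {B : FiniteRootedGraph | B.card ≤ M} ⊆
      Set.range fun p : Σ n : Fin (M + 1), SimpleGraph (Fin n) × Fin n =>
        (⟨p.1, p.2.1, p.2.2⟩ : FiniteRootedGraph) :=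
    fun B hB => ⟨⟨⟨B.card, Nat.lt_succ_of_le hB⟩, B.graph, B.root⟩, rfl⟩
  exact (Set.finite_range _).subset hsub

end RootedBalls

section NaiveLimits

variable {V : ℕ → Type*} {G : ∀ n, SimpleGraph (V n)} {W : Type*} {H : SimpleGraph W} {d : ℕ}

theorem NaiveLimit.eventually_mem_rootedBalls_iff (hlim : NaiveLimit G H) {r : ℕ} (hr : 0 < r)
    (B : FiniteRootedGraph) :
    ∀ᶠ n in Filter.atTop, B ∈ rootedBalls (G n) r ↔ B ∈ rootedBalls H r := by
  by_cases hB : B ∈ rootedBalls H r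
  · filter_upwards [Filter.eventually_atTop.2 ((hlim.2 r hr B).1 hB)] with n hn
    exact iff_of_true hn hB
  · have hout := (hlim.1 r hr B).resolve_left fun hin => hB ((hlim.2 r hr B).2 hin)
    filter_upwards [Filter.eventually_atTop.2 hout] with n hn
    exact iff_of_false hn hB

theorem NaiveLimit.eventually_rootedBalls_eq (hlim : NaiveLimit G H)
    (hG : ∀ n, DegreeBound (G n) d) (hH : DegreeBound H d) {r : ℕ} (hr : 0 < r) :
    ∀ᶠ n in Filter.atTop, rootedBalls (G n) r = rootedBalls H r := by
  filter_upwards [(Filter.eventually_all_finite (finite_setOf_card_le ((d + 1) ^ r))).2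
    fun B _ => hlim.eventually_mem_rootedBalls_iff hr B] with n hn
  ext B
  by_cases hB : B.card ≤ (d + 1) ^ r
  · exact hn B hB
  · exact iff_of_false (mt (card_le_of_mem_rootedBalls (hG n)) hB)
      (mt (card_le_of_mem_rootedBalls hH) hB)

theorem NaiveLimit.eventually_exists_hasLocalEigenfunction_iff (hlim : NaiveLimit G H)
    (hG : ∀ n, DegreeBound (G n) d) (hH : DegreeBound H d) (r : ℕ) :
    ∀ᶠ n in Filter.atTop, ∀ (z : ℂ) (δ : ℝ≥0),
      (∃ x, HasLocalEigenfunction (G n) z δ r x) ↔ ∃ x, HasLocalEigenfunction H z δ r x := by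
  filter_upwards [hlim.eventually_rootedBalls_eq hG hH r.succ_pos] with n hn z δ
  rw [exists_hasLocalEigenfunction_iff (hG n), exists_hasLocalEigenfunction_iff hH, hn]

end NaiveLimits

section HausdorffConvergence

theorem eventually_forall_infEDist_le {X ι : Type*} [PseudoEMetricSpace X] {l : Filter ι}
    {K : Set X} (hK : IsCompact K) {S : ι → Set X}
    (h : ∀ x ∈ K, ∀ δ : ℝ≥0, 0 < δ → ∀ᶠ n in l, Metric.infEDist x (S n) ≤ δ) {δ : ℝ≥0}
    (hδ : 0 < δ) : ∀ᶠ n in l, ∀ x ∈ K, Metric.infEDist x (S n) ≤ δ := by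
  have hδ₂ : (0 : ℝ≥0∞) < (δ / 2 : ℝ≥0) := by exact_mod_cast half_pos hδ
  refine hK.induction_on (by simp) (fun s t hst ht => ?_) (fun s t hs ht => ?_) fun x hx => ?_
  · exact ht.mono fun n hn x hx => hn x (hst hx)
  · filter_upwards [hs, ht] with n hsn htn x hx using hx.elim (hsn x) (htn x)
  · refine ⟨_, mem_nhdsWithin_of_mem_nhds (Metric.eball_mem_nhds x hδ₂), ?_⟩
    filter_upwards [h x hx (δ / 2) (half_pos hδ)] with n hn y hy
    calc Metric.infEDist y (S n) ≤ edist y x + Metric.infEDist x (S n) :=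
          Metric.infEDist_le_edist_add_infEDist
      _ ≤ (δ / 2 : ℝ≥0) + (δ / 2 : ℝ≥0) := add_le_add hy.le hn
      _ = δ := by exact_mod_cast add_halves δ

variable {V : ℕ → Type*} {G : ∀ n, SimpleGraph (V n)} {W : Type*} {H : SimpleGraph W} {d : ℕ}

theorem NaiveLimit.eventually_infEDist_spectrum_le_of_uniformPropertyA (hlim : NaiveLimit G H)
    (hG : ∀ n, DegreeBound (G n) d) (hH : DegreeBound H d) (hA : UniformPropertyA G) {δ : ℝ≥0}
    (hδ : 0 < δ) :
    ∀ᶠ n in Filter.atTop, ∀ z ∈ spectrum ℂ (laplacian (G n) d (hG n)),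
      Metric.infEDist z (spectrum ℂ (laplacian H d hH)) ≤ δ := by
  obtain ⟨r, hr⟩ := hA.exists_hasLocalEigenfunction hG hδ
  filter_upwards [hlim.eventually_exists_hasLocalEigenfunction_iff hG hH r] with n hn z hz
  obtain ⟨x, f, -, hf⟩ := (hn z δ).1 (hr n z hz)
  exact hf.infEDist_spectrum_le hH

theorem NaiveLimit.eventually_infEDist_spectrum_le (hlim : NaiveLimit G H)
    (hG : ∀ n, DegreeBound (G n) d) (hH : DegreeBound H d) {δ : ℝ≥0} (hδ : 0 < δ) :
    ∀ᶠ n in Filter.atTop, ∀ z ∈ spectrum ℂ (laplacian H d hH),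
      Metric.infEDist z (spectrum ℂ (laplacian (G n) d (hG n))) ≤ δ := by
  refine eventually_forall_infEDist_le (spectrum.isCompact _) (fun z hz ε hε => ?_) hδ
  obtain ⟨r, hr⟩ := exists_hasLocalEigenfunction_of_mem_spectrum hH hz hε
  filter_upwards [hlim.eventually_exists_hasLocalEigenfunction_iff hG hH r] with n hn
  obtain ⟨x, f, -, hf⟩ := (hn z ε).2 hr
  exact hf.infEDist_spectrum_le (hG n)

end HausdorffConvergence

end GraphLimit

theorem mainTheorem6_general (d : ℕ)
    (V : ℕ → Type*) (G : ∀ n, SimpleGraph (V n))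
    (hG : ∀ n, GraphLimit.DegreeBound (G n) d)
    (W : Type*) (H : SimpleGraph W) (hH : GraphLimit.DegreeBound H d)
    (hA : GraphLimit.UniformPropertyA G) (hlim : GraphLimit.NaiveLimit G H) :
    Filter.Tendsto
      (fun n => Metric.hausdorffEDist
        (spectrum ℂ (GraphLimit.laplacian (G n) d (hG n)))
        (spectrum ℂ (GraphLimit.laplacian H d hH)))
      Filter.atTop (nhds 0) := by
  rw [ENNReal.tendsto_nhds_zero]
  intro ε hε
  obtain ⟨δ, hδ, hδε⟩ := ENNReal.lt_iff_exists_nnreal_btwn.1 hε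
  have hδ₀ : 0 < δ := by exact_mod_cast hδ
  filter_upwards [hlim.eventually_infEDist_spectrum_le_of_uniformPropertyA hG hH hA hδ₀,
    hlim.eventually_infEDist_spectrum_le hG hH hδ₀] with n hnear hcover
  exact (Metric.hausdorffEDist_le_of_infEDist hnear hcover).trans hδε.le

theorem mainTheorem6 (d : ℕ)
    (V : ℕ → Type*) [∀ n, Countable (V n)] (G : ∀ n, SimpleGraph (V n))
    (hG : ∀ n, GraphLimit.DegreeBound (G n) d)
    (W : Type*) [Countable W] (H : SimpleGraph W) (hH : GraphLimit.DegreeBound H d)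
    (hsaf : GraphLimit.StronglyAlmostFinite G) (hlim : GraphLimit.NaiveLimit G H) :
    Filter.Tendsto
      (fun n => Metric.hausdorffEDist
        (spectrum ℂ (GraphLimit.laplacian (G n) d (hG n)))
        (spectrum ℂ (GraphLimit.laplacian H d hH)))
      Filter.atTop (nhds 0) :=
  mainTheorem6_general d V G hG W H hH hsaf.uniformPropertyA hlim
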